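/- Let $\mathcal W=\mathbb C\langle a,a^\dagger\rangle/(aa^\dagger-a^\dagger a-1)$ be the single-mode Heisenberg--Weyl algebra. For $s\in\mathbb C$ let $F\mapsto\,:\!F\!:_s$ be the $s$-quantization: the linear map $\mathbb C[\alpha,\alpha^*]\to\mathcal W$ ($\alpha,\alpha^*$ commuting indeterminates) determined on monomials by $$e^{-s\beta\beta^*/2}\exp(\beta a^\dagger-\beta^*a)=\sum_{n,m\ge0}\frac{\beta^n(-\beta^*)^m}{n!\,m!}\,:\!{\alpha^*}^n\alpha^m\!:_s\quad\text{in }\mathcal W[[\beta,\beta^*]],$$ ($\beta,\beta^*$ independent commuting indeterminates), extended coefficientwise to $\mathbb C[\alpha,\alpha^*][[\lambda]]\to\mathcal W[[\lambda]]$. Inside $:\ldots:_s$ write $a,a^\dagger$ for the commuting $\alpha,\alpha^*$. Put $$Q_s=1+2s\lambda a^\dagger+\lambda^2{a^\dagger}^2,\qquad \mathcal E=\exp\!\left[(a^\dagger a)\,\frac{2\lambda a^\dagger}{1+s\lambda a^\dagger+\sqrt{Q_s}}\right],$$ where $\sqrt{Q_s}$ is the formal square root with constant term $1$. Then, as identities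 in $\mathcal W[[\lambda]]$, for all $s\in\mathbb C$, $$e^{\lambda({a^\dagger}^2a)}=\;:\frac{1+s}{Q_s+(\lambda a^\dagger+s)\sqrt{Q_s}}\,\mathcal E:_s,$$ $$e^{\lambda(a^\dagger aa^\dagger)}=\;:\frac{1}{\sqrt{Q_s}}\,\mathcal E:_s,$$ $$e^{\lambda(a{a^\dagger}^2)}=\;:\frac{1-s}{Q_s-(\lambda a^\dagger+s)\sqrt{Q_s}}\,\mathcal E:_s.$$ Here, in the first identity at $s=-1$ and in the third at $s=1$, the quotient in front of $\mathcal E$ (in which numerator and constant term of the denominator vanish) is to be read as its coefficientwise limit as $s\to-1$, respectively $s\to1$; in both cases this limit exists and is the constant series $1$. -/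

import Mathlib

open Filter Topology PowerSeries

noncomputable section

namespace SOrdering

/-! ### The Heisenberg-Weyl algebra -/

/-- The two noncommuting generators. -/
inductive Ladder : Type
  | ann
  | cre

/-- The commutation relation `a a† = a† a + 1` on the free algebra. -/
inductive CCR : FreeAlgebra ℂ Ladder → FreeAlgebra ℂ Ladder → Prop
  | comm : CCR
      (FreeAlgebra.ι ℂ Ladder.ann * FreeAlgebra.ι ℂ Ladder.cre)
      (FreeAlgebra.ι ℂ Ladder.cre * FreeAlgebra.ι ℂ Ladder.ann + 1)

/-- The single-mode Heisenberg-Weyl algebra `ℂ⟨a, a†⟩ / (a a† - a† a - 1)`. -/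
abbrev Weyl : Type := RingQuot CCR

/-- The annihilation operator. -/
def a : Weyl := RingQuot.mkAlgHom ℂ CCR (FreeAlgebra.ι ℂ Ladder.ann)

/-- The creation operator `a†`. -/
def ad : Weyl := RingQuot.mkAlgHom ℂ CCR (FreeAlgebra.ι ℂ Ladder.cre)

theorem a_mul_ad : a * ad = ad * a + 1 := by
  have h := RingQuot.mkAlgHom_rel ℂ CCR.comm
  simpa [a, ad] using h

/-! ### Exponentials and square roots of formal power series -/

/-- The exponential `∑ F ^ k / k!` of a formal power series `F` with zero constant term, in
arbitrarily many commuting indeterminates and with coefficients in a possibly noncommutative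
algebra. As `F ^ k` has no term of total degree below `k`, only the `k` up to the total degree
of `d` contribute to the coefficient at `d`. -/
def formalExp {σ A : Type} [Ring A] [Algebra ℂ A] (F : MvPowerSeries σ A) : MvPowerSeries σ A :=
  fun d => ∑ k ∈ Finset.range (d.degree + 1),
    ((Nat.factorial k : ℂ)⁻¹) • MvPowerSeries.coeff d (F ^ k)

/-- The square root of a formal power series `φ` over `ℂ` with constant term `1`:
the binomial series of exponent `1 / 2`, evaluated at `φ - 1`. -/
def formalSqrt (φ : ℂ⟦X⟧) : ℂ⟦X⟧ :=
  (PowerSeries.binomialSeries ℂ (1 / 2 : ℂ)).subst (φ - 1)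

theorem formalSqrt_sq {φ : ℂ⟦X⟧} (h : constantCoeff φ = 1) : formalSqrt φ ^ 2 = φ := by
  have hs : PowerSeries.HasSubst (φ - 1) :=
    PowerSeries.HasSubst.of_constantCoeff_zero' (by simp [h])
  have h1 : PowerSeries.binomialSeries ℂ (1 / 2 : ℂ) * PowerSeries.binomialSeries ℂ (1 / 2 : ℂ)
      = (1 + PowerSeries.X : ℂ⟦X⟧) := by
    rw [← PowerSeries.binomialSeries_add]
    have := PowerSeries.binomialSeries_nat (R := ℂ) (A := ℂ) 1
    norm_num at this ⊢
    exact this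
  have h2 : (1 : ℂ⟦X⟧).subst (φ - 1) = (1 : ℂ⟦X⟧) := by
    rw [← PowerSeries.coe_substAlgHom hs, map_one]
  rw [formalSqrt, sq, ← PowerSeries.subst_mul hs, h1, PowerSeries.subst_add hs,
    PowerSeries.subst_X hs, h2]
  ring

theorem constantCoeff_formalSqrt {φ : ℂ⟦X⟧} (h : constantCoeff φ = 1) :
    constantCoeff (formalSqrt φ) = 1 := by
  have hs : PowerSeries.HasSubst (φ - 1) :=
    PowerSeries.HasSubst.of_constantCoeff_zero' (by simp [h])
  have e : PowerSeries.binomialSeries ℂ (1 / 2 : ℂ)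
      = (PowerSeries.binomialSeries ℂ (1 / 2 : ℂ) - 1) + 1 := by ring
  have h2 : (1 : ℂ⟦X⟧).subst (φ - 1) = (1 : ℂ⟦X⟧) := by
    rw [← PowerSeries.coe_substAlgHom hs, map_one]
  have h3 := PowerSeries.constantCoeff_subst_eq_zero (a := φ - 1)
    (by change constantCoeff (φ - 1) = 0; simp [h])
    (PowerSeries.binomialSeries ℂ (1 / 2 : ℂ) - 1)
    (by simp [PowerSeries.binomialSeries_constantCoeff])
  rw [formalSqrt, e, PowerSeries.subst_add hs, h2, map_add, map_one]
  change constantCoeff _ = 0 at h3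
  rw [h3, zero_add]

/-! ### `s`-ordering -/

/-- The displacement operator `D(β, β*) = exp (β a† - β* a)` in `𝒲[[β, β*]]`,
where `β = X 0` and `β* = X 1` are independent commuting indeterminates. -/
def displacement : MvPowerSeries (Fin 2) Weyl :=
  formalExp (MvPowerSeries.X 0 * MvPowerSeries.C ad - MvPowerSeries.X 1 * MvPowerSeries.C a)

/-- The deformation `D(β, β*; s) = exp (s β (-β*) / 2) D(β, β*)`. -/
def displacementS (s : ℂ) : MvPowerSeries (Fin 2) Weyl :=
  formalExp ((s / 2) • (MvPowerSeries.X 0 * -MvPowerSeries.X 1)) * displacement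

/-- The ring `ℂ[α, α*]` of classical polynomials. -/
abbrev Classical : Type := MvPolynomial (Fin 2) ℂ

/-- The commuting indeterminate `α*`, which stands for `a†` inside an ordering symbol. -/
def αstar : Classical := MvPolynomial.X 0

/-- The commuting indeterminate `α`, which stands for `a` inside an ordering symbol. -/
def α : Classical := MvPolynomial.X 1

/-- The `s`-quantization `F ↦ :F:_s` of classical polynomials. It is linear and is fixed on
monomials by `D(β, β*; s) = ∑ β ^ n (-β*) ^ m / (n! m!) :(α*) ^ n α ^ m:_s`. -/
def quantize (s : ℂ) : Classical →ₗ[ℂ] Weyl :=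
  (MvPolynomial.basisMonomials (Fin 2) ℂ).constr ℂ fun d =>
    ((-1 : ℂ) ^ (d 1) * (Nat.factorial (d 0) : ℂ) * (Nat.factorial (d 1) : ℂ)) •
      MvPowerSeries.coeff d (displacementS s)

/-- The `s`-quantization of formal power series in `λ` with coefficients in `ℂ[α, α*]`,
coefficient by coefficient. -/
def quantizeSeries (s : ℂ) (F : Classical⟦X⟧) : Weyl⟦X⟧ :=
  PowerSeries.mk fun n => quantize s (coeff n F)

/-- `exp (λ ω)` in `𝒲[[λ]]`. -/
def expOp (ω : Weyl) : Weyl⟦X⟧ :=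
  formalExp (PowerSeries.X * PowerSeries.C ω : Weyl⟦X⟧)

/-! ### The classical representations -/

/-- The substitution `z = λ α*`, which takes `φ(z)` in `ℂ[[z]]` to `φ(λ α*)`
in `ℂ[α, α*][[λ]]`. -/
def atLamAstar (φ : ℂ⟦X⟧) : Classical⟦X⟧ :=
  PowerSeries.mk fun n => MvPolynomial.C (coeff n φ) * αstar ^ n

/-- `1 + 2 s z + z²` -/
def quad (s : ℂ) : ℂ⟦X⟧ := 1 + C (2 * s) * X + X ^ 2

/-- `√(1 + 2 s z + z²)` -/
def root (s : ℂ) : ℂ⟦X⟧ := formalSqrt (quad s)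

/-- `2 z / (1 + s z + √(1 + 2 s z + z²))`; the constant term of the denominator is `2`. -/
def expo (s : ℂ) : ℂ⟦X⟧ := C 2 * X * (1 + C s * X + root s)⁻¹

/-- The common factor `ℰ`, that is `exp [(α* α) 2 λ α* / (1 + s λ α* + √(1 + 2 s λ α* + λ² α*²))]`. -/
def commonFactor (s : ℂ) : Classical⟦X⟧ :=
  formalExp (C (αstar * α) * atLamAstar (expo s) : Classical⟦X⟧)

/-- `(1 + s) / (1 + 2 s z + z² + (z + s) √(1 + 2 s z + z²))`;
the constant term of the denominator is `1 + s`. -/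
def prefactor20 (s : ℂ) : ℂ⟦X⟧ := C (1 + s) * (quad s + (X + C s) * root s)⁻¹

/-- `1 / √(1 + 2 s z + z²)` -/
def prefactor11 (s : ℂ) : ℂ⟦X⟧ := (root s)⁻¹

/-- `(1 - s) / (1 + 2 s z + z² - (z + s) √(1 + 2 s z + z²))`;
the constant term of the denominator is `1 - s`. -/
def prefactor02 (s : ℂ) : ℂ⟦X⟧ := C (1 - s) * (quad s - (X + C s) * root s)⁻¹

end SOrdering

end

/-! Each operator has the normal form ω = a†² a + k a† with k = 0, 1, 2, and exp(λω) is fixed by its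
constant term 1 and the recursion (n + 1) c_{n+1} = ω c_n. It therefore suffices that the proposed
right-hand side obeys the same recursion.

Put c = -(1 + s)/2 and d = (1 - s)/2, so d - c = 1. Applying the Euler operators β∂_β and β*∂_{β*}
to the deformed displacement operator shows that left multiplication by a† and a acts on s-ordered
symbols as α* + c ∂_α and α + d ∂_{α*} (`ad_mul_quantize`, `a_mul_quantize`). The recursion becomes
a linear differential equation for the symbol. With the ansatz p(z) exp(α* α e(z)), z = λα*, both
sides have degree at most one in α beside the exponential. The part linear in α is an equation for
e, the part free of α one for p (`euler_representation`).

The exponent solves e = z(1 + ce)(1 + de) (`expo_algebraic`), and implicit differentiation gives its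
equation. The solution for p is (1 + ce)^j (1 + de)^k / (1 - cde²) with j + k = 2
(`derivative_prefactor`). This form is regular for every s. It agrees with the stated quotients
where their denominators are invertible (`prefactor20_eq`, `prefactor11_eq`, `prefactor02_eq`), and
its coefficients are continuous in s, which yields the two limits. -/

noncomputable section

namespace SOrdering

/-! ### Derivations acting coefficientwise, and exponentials -/

section Exponential

variable {σ A : Type} [Ring A] [Algebra ℂ A]

/-- The linear map on formal power series that applies `ψ d` to the coefficient at `d`. -/
def coeffwise (ψ : (σ →₀ ℕ) → A →ₗ[ℂ] A) : MvPowerSeries σ A →ₗ[ℂ] MvPowerSeries σ A where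
  toFun f := fun d => ψ d (MvPowerSeries.coeff d f)
  map_add' f g := by ext d; exact map_add (ψ d) _ _
  map_smul' r f := by ext d; exact map_smul (ψ d) r _

theorem coeff_coeffwise (ψ : (σ →₀ ℕ) → A →ₗ[ℂ] A) (f : MvPowerSeries σ A) (d : σ →₀ ℕ) :
    MvPowerSeries.coeff d (coeffwise ψ f) = ψ d (MvPowerSeries.coeff d f) := rfl

/-- The Leibniz rule for a family of maps acting on coefficients. -/
def IsLeibniz (ψ : (σ →₀ ℕ) → A →ₗ[ℂ] A) : Prop :=
  ∀ d e x y, ψ (d + e) (x * y) = ψ d x * y + x * ψ e y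

/-- The index in `IsLeibniz` is additive, as on the antidiagonal. This covers both Euler operators
(weight `d i`) and derivations of the coefficient ring (independent of `d`). -/
theorem coeffwise_mul {ψ : (σ →₀ ℕ) → A →ₗ[ℂ] A} (h : IsLeibniz ψ) (f g : MvPowerSeries σ A) :
    coeffwise ψ (f * g) = coeffwise ψ f * g + f * coeffwise ψ g := by
  classical
  ext d
  rw [map_add, coeff_coeffwise, MvPowerSeries.coeff_mul, MvPowerSeries.coeff_mul,
    MvPowerSeries.coeff_mul, map_sum, ← Finset.sum_add_distrib]
  refine Finset.sum_congr rfl fun p hp => ?_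
  rw [← Finset.HasAntidiagonal.mem_antidiagonal.mp hp, h]
  rfl

theorem coeffwise_one {ψ : (σ →₀ ℕ) → A →ₗ[ℂ] A} (h : IsLeibniz ψ) :
    coeffwise ψ (1 : MvPowerSeries σ A) = 0 := by
  have := coeffwise_mul h 1 1
  simpa using this

theorem coeff_pow_eq_zero {σ A : Type} [Ring A] {F : MvPowerSeries σ A}
    (hF : MvPowerSeries.constantCoeff F = 0)
    {d : σ →₀ ℕ} {k : ℕ} (hk : d.degree < k) : MvPowerSeries.coeff d (F ^ k) = 0 :=
  MvPowerSeries.coeff_of_lt_order <|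
    lt_of_lt_of_le (by exact_mod_cast hk) (MvPowerSeries.le_order_pow_of_constantCoeff_eq_zero k hF)

theorem coeff_complex_smul (r : ℂ) (f : MvPowerSeries σ A) (d : σ →₀ ℕ) :
    MvPowerSeries.coeff d (r • f) = r • MvPowerSeries.coeff d f := rfl

/-- The partial sums `∑ k < N, F ^ k / k!` of the exponential series. -/
def expTrunc (F : MvPowerSeries σ A) (N : ℕ) : MvPowerSeries σ A :=
  ∑ k ∈ Finset.range N, ((Nat.factorial k : ℂ)⁻¹) • F ^ k

/-- The cutoff may be any N above the degree, so all coefficients entering a product or a derivative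
can share one finite sum. -/
theorem coeff_formalExp {F : MvPowerSeries σ A} (hF : MvPowerSeries.constantCoeff F = 0)
    {d : σ →₀ ℕ} {N : ℕ} (hN : d.degree < N) :
    MvPowerSeries.coeff d (formalExp F) = MvPowerSeries.coeff d (expTrunc F N) := by
  have h1 : MvPowerSeries.coeff d (formalExp F) = ∑ k ∈ Finset.range (d.degree + 1),
    ((Nat.factorial k : ℂ)⁻¹) • MvPowerSeries.coeff d (F ^ k) := rfl
  rw [h1, expTrunc, map_sum]
  refine Finset.sum_subset_zero_on_sdiff (Finset.range_mono hN) (fun k hk => ?_) fun k _ => ?_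
  · rw [Finset.mem_sdiff, Finset.mem_range, Finset.mem_range] at hk
    rw [coeff_complex_smul, coeff_pow_eq_zero hF (by omega), smul_zero]
  · rw [coeff_complex_smul]

theorem coeff_mul_formalExp {F : MvPowerSeries σ A} (hF : MvPowerSeries.constantCoeff F = 0)
    (V : MvPowerSeries σ A) {d : σ →₀ ℕ} {N : ℕ} (hN : d.degree < N) :
    MvPowerSeries.coeff d (V * formalExp F) = MvPowerSeries.coeff d (V * expTrunc F N) := by
  classical
  rw [MvPowerSeries.coeff_mul, MvPowerSeries.coeff_mul]
  refine Finset.sum_congr rfl fun p hp => ?_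
  have h := congrArg Finsupp.degree (Finset.HasAntidiagonal.mem_antidiagonal.mp hp)
  rw [map_add] at h
  rw [coeff_formalExp hF (N := N) (by omega)]

theorem coeff_formalExp_mul {F : MvPowerSeries σ A} (hF : MvPowerSeries.constantCoeff F = 0)
    (V : MvPowerSeries σ A) {d : σ →₀ ℕ} {N : ℕ} (hN : d.degree < N) :
    MvPowerSeries.coeff d (formalExp F * V) = MvPowerSeries.coeff d (expTrunc F N * V) := by
  classical
  rw [MvPowerSeries.coeff_mul, MvPowerSeries.coeff_mul]
  refine Finset.sum_congr rfl fun p hp => ?_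
  have h := congrArg Finsupp.degree (Finset.HasAntidiagonal.mem_antidiagonal.mp hp)
  rw [map_add] at h
  rw [coeff_formalExp hF (N := N) (by omega)]

theorem commute_formalExp {F V : MvPowerSeries σ A} (hF : MvPowerSeries.constantCoeff F = 0)
    (h : Commute V F) : Commute V (formalExp F) := by
  refine MvPowerSeries.ext fun d => ?_
  rw [coeff_mul_formalExp hF V (Nat.lt_succ_self _), coeff_formalExp_mul hF V (Nat.lt_succ_self _)]
  congr 1
  exact Commute.sum_right _ _ _ fun k _ => (h.pow_right k).smul_right _

theorem coeff_zero_formalExp (F : MvPowerSeries σ A) :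
    MvPowerSeries.coeff 0 (formalExp F) = 1 := by
  have h1 : MvPowerSeries.coeff 0 (formalExp F) = ∑ k ∈ Finset.range ((0 : σ →₀ ℕ).degree + 1),
    ((Nat.factorial k : ℂ)⁻¹) • MvPowerSeries.coeff 0 (F ^ k) := rfl
  rw [h1]
  simp

section Derivative

variable {ψ : (σ →₀ ℕ) → A →ₗ[ℂ] A} {F Z W : MvPowerSeries σ A}

/-- Moving the derivative Z to the left past i factors F costs i W F^(i-1). Summing over i < m gives
the binomial coefficient m(m - 1)/2, here with m = n + 2. -/
theorem coeffwise_pow (h : IsLeibniz ψ) (hZ : coeffwise ψ F = Z) (hW : F * Z = Z * F + W)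
    (hc : Commute F W) (n : ℕ) :
    coeffwise ψ (F ^ (n + 2)) = ((n : ℂ) + 2) • (Z * F ^ (n + 1)) +
      (((n : ℂ) + 2) * (n + 1) / 2) • (W * F ^ n) := by
  induction n with
  | zero =>
    rw [pow_two, coeffwise_mul h, hZ, hW, pow_zero, mul_one, zero_add, pow_one]
    simp only [Nat.cast_zero]
    module
  | succ n ih =>
    have e1 : F * (Z * F ^ (n + 1)) = Z * F ^ (n + 2) + W * F ^ (n + 1) := by
      rw [← mul_assoc, hW, add_mul, mul_assoc, ← pow_succ']
    have e2 : F * (W * F ^ n) = W * F ^ (n + 1) := by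
      rw [← mul_assoc, hc.eq, mul_assoc, ← pow_succ']
    rw [pow_succ' F (n + 2), coeffwise_mul h, hZ, ih, mul_add, mul_smul_comm, mul_smul_comm, e1, e2]
    push_cast
    module

theorem coeffwise_expTrunc (h : IsLeibniz ψ) (hZ : coeffwise ψ F = Z) (hW : F * Z = Z * F + W)
    (hc : Commute F W) (n : ℕ) :
    coeffwise ψ (expTrunc F (n + 2)) =
      Z * expTrunc F (n + 1) + ((1 / 2 : ℂ) • W) * expTrunc F n := by
  induction n with
  | zero => simp [expTrunc, Finset.sum_range_succ, coeffwise_one h, hZ]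
  | succ n ih =>
    have s : ∀ m, expTrunc F (m + 1) = expTrunc F m + ((Nat.factorial m : ℂ)⁻¹) • F ^ m :=
      fun m => Finset.sum_range_succ _ _
    rw [s (n + 2), map_add, map_smul, ih, coeffwise_pow h hZ hW hc, s (n + 1), s n, mul_add Z, mul_add Z,
      mul_add Z, mul_add ((1 / 2 : ℂ) • W), smul_add, smul_smul, smul_smul, mul_smul_comm, mul_smul_comm,
      mul_smul_comm, smul_mul_assoc, smul_mul_assoc, smul_smul]
    have h0 : (Nat.factorial n : ℂ) ≠ 0 := by exact_mod_cast Nat.factorial_ne_zero n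
    have h1 : (n : ℂ) + 1 ≠ 0 := by exact_mod_cast Nat.succ_ne_zero n
    have h2 : (n : ℂ) + 2 ≠ 0 := by exact_mod_cast Nat.succ_ne_zero (n + 1)
    have f1 : ((Nat.factorial (n + 2) : ℂ))⁻¹ * ((n : ℂ) + 2) = (Nat.factorial (n + 1) : ℂ)⁻¹ := by
      rw [Nat.factorial_succ (n + 1), Nat.factorial_succ n]; push_cast
      rw [show (n : ℂ) + 1 + 1 = n + 2 by ring]; field_simp
    have f2 : ((Nat.factorial (n + 2) : ℂ))⁻¹ * (((n : ℂ) + 2) * (n + 1) / 2) =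
        (Nat.factorial n : ℂ)⁻¹ * (1 / 2) := by
      rw [Nat.factorial_succ (n + 1), Nat.factorial_succ n]; push_cast
      rw [show (n : ℂ) + 1 + 1 = n + 2 by ring]; field_simp
    rw [f1, f2]
    abel

/-- The derivative of an exponential `exp F` where the commutator of `F` with its derivative
commutes with `F`. -/
theorem coeffwise_formalExp (h : IsLeibniz ψ) (hF : MvPowerSeries.constantCoeff F = 0)
    (hZ : coeffwise ψ F = Z) (hW : F * Z = Z * F + W) (hc : Commute F W) :
    coeffwise ψ (formalExp F) = (Z + (1 / 2 : ℂ) • W) * formalExp F := by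
  refine MvPowerSeries.ext fun d => ?_
  -- The derivative shortens the truncation by one in the Z term and by two in the W term; the
  -- surplus keeps both cutoffs above the degree.
  rw [coeff_coeffwise, coeff_formalExp hF (N := d.degree + 1 + 2) (by omega), ← coeff_coeffwise,
    coeffwise_expTrunc h hZ hW hc, add_mul, map_add, map_add,
    coeff_mul_formalExp hF Z (N := d.degree + 1 + 1) (by omega),
    coeff_mul_formalExp hF _ (N := d.degree + 1) (by omega)]

end Derivative

end Exponential

/-! ### The ladder operators on `s`-ordered symbols -/

/-- Multiplication of the coefficient at `d` by `d i`. -/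
def eulerFamily {σ A : Type} [Ring A] [Algebra ℂ A] (i : σ) (d : σ →₀ ℕ) : A →ₗ[ℂ] A :=
  (d i : ℂ) • LinearMap.id

theorem isLeibniz_eulerFamily {σ A : Type} [Ring A] [Algebra ℂ A] (i : σ) :
    IsLeibniz (eulerFamily (A := A) i) := by
  intro d e x y
  simp only [eulerFamily, LinearMap.smul_apply, LinearMap.id_apply, Finsupp.add_apply,
    smul_mul_assoc, mul_smul_comm]
  push_cast
  module

theorem coeffwise_euler_C {σ A : Type} [Ring A] [Algebra ℂ A] (i : σ) (x : A) :
    coeffwise (eulerFamily i) (MvPowerSeries.C x : MvPowerSeries σ A) = 0 := by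
  classical
  ext d
  rw [coeff_coeffwise, MvPowerSeries.coeff_C]
  split_ifs with h <;> simp [eulerFamily, h]

theorem coeffwise_euler_X {σ A : Type} [DecidableEq σ] [Ring A] [Algebra ℂ A] (i j : σ) :
    coeffwise (eulerFamily i) (MvPowerSeries.X j : MvPowerSeries σ A) =
      if i = j then MvPowerSeries.X j else 0 := by
  ext d
  rw [coeff_coeffwise, MvPowerSeries.coeff_X]
  split_ifs with h h' h' <;> simp [eulerFamily, MvPowerSeries.coeff_X, h, h']

theorem commute_X_left {σ A : Type} [Ring A] (i : σ) (V : MvPowerSeries σ A) :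
    Commute (MvPowerSeries.X i) V := (MvPowerSeries.commute_X V i).symm

theorem central_mul_mul_central_mul {R : Type} [Ring R] {x y : R} (hx : ∀ v, Commute x v)
    (p q : R) : (y * q) * (x * p) = (y * x) * (q * p) := by
  rw [mul_assoc, ← mul_assoc q, ← (hx q).eq, mul_assoc x, ← mul_assoc]

/-! ### Euler equations of the ordered displacement operator -/

section Displacement

/-- The exponent `β p - β* q` of the displacement operator. -/
def displacementExponent {A : Type} [Ring A] (p q : A) : MvPowerSeries (Fin 2) A :=
  MvPowerSeries.X 0 * MvPowerSeries.C p - MvPowerSeries.X 1 * MvPowerSeries.C q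

variable {A : Type} [Ring A] [Algebra ℂ A]

variable (A) in
/-- The exponent of the factor that deforms the displacement operator. -/
def orderingExponent (s : ℂ) : MvPowerSeries (Fin 2) A :=
  (s / 2) • (MvPowerSeries.X 0 * -MvPowerSeries.X 1)

/-- The operator `exp (s β (-β*) / 2) exp (β p - β* q)`. -/
def orderedDisplacement (s : ℂ) (p q : A) : MvPowerSeries (Fin 2) A :=
  formalExp (orderingExponent A s) * formalExp (displacementExponent p q)

theorem commute_orderingExponent (s : ℂ) (V : MvPowerSeries (Fin 2) A) :
    Commute V (orderingExponent A s) :=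
  ((MvPowerSeries.commute_X V 0).mul_right (MvPowerSeries.commute_X V 1).neg_right).smul_right _

theorem constantCoeff_displacementExponent {A : Type} [Ring A] (p q : A) :
    MvPowerSeries.constantCoeff (displacementExponent p q) = 0 := by
  simp [displacementExponent]

theorem constantCoeff_orderingExponent (s : ℂ) :
    MvPowerSeries.constantCoeff (orderingExponent A s) = 0 := by
  rw [← MvPowerSeries.coeff_zero_eq_constantCoeff_apply, orderingExponent,
    coeff_complex_smul, MvPowerSeries.coeff_zero_X_mul, smul_zero]

theorem coeffwise_ordering (s : ℂ) (i : Fin 2) :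
    coeffwise (eulerFamily i) (formalExp (orderingExponent A s)) =
      orderingExponent A s * formalExp (orderingExponent A s) := by
  have hZ : coeffwise (eulerFamily i) (orderingExponent A s) = orderingExponent A s := by
    rw [orderingExponent, map_smul, coeffwise_mul (isLeibniz_eulerFamily i), map_neg,
      coeffwise_euler_X, coeffwise_euler_X]
    fin_cases i <;> simp
  simpa using coeffwise_formalExp (isLeibniz_eulerFamily i) (constantCoeff_orderingExponent s) hZ
    (W := 0) (by simp) (Commute.zero_right _)

variable {p q : A}

theorem C_mul_C_of_ccr {A : Type} [Ring A] {p q : A} (h : q * p = p * q + 1) :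
    (MvPowerSeries.C q * MvPowerSeries.C p : MvPowerSeries (Fin 2) A) =
      MvPowerSeries.C p * MvPowerSeries.C q + 1 := by
  rw [← map_mul, h, map_add, map_mul, map_one]

/-- With Z = βp the commutator of the exponent with Z is the central element -ββ*; half of it is the
correction term. -/
theorem coeffwise_displacement_zero (h : q * p = p * q + 1) :
    coeffwise (eulerFamily 0) (formalExp (displacementExponent p q)) =
      (MvPowerSeries.X 0 * MvPowerSeries.C p +
        (1 / 2 : ℂ) • -(MvPowerSeries.X 0 * MvPowerSeries.X 1)) *
          formalExp (displacementExponent p q) := by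
  refine coeffwise_formalExp (isLeibniz_eulerFamily 0) (constantCoeff_displacementExponent p q)
    ?_ ?_ ?_
  · rw [displacementExponent, map_sub, coeffwise_mul (isLeibniz_eulerFamily 0),
      coeffwise_mul (isLeibniz_eulerFamily 0)]
    simp [coeffwise_euler_X, coeffwise_euler_C]
  · have h0 := commute_X_left (A := A) (0 : Fin 2)
    have h1 := commute_X_left (A := A) (1 : Fin 2)
    rw [displacementExponent, sub_mul, mul_sub, central_mul_mul_central_mul h0,
      central_mul_mul_central_mul h0, central_mul_mul_central_mul h1, C_mul_C_of_ccr h, (h1 _).eq]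
    noncomm_ring
  · exact Commute.neg_right (Commute.mul_right (MvPowerSeries.commute_X _ (0 : Fin 2))
      (MvPowerSeries.commute_X _ (1 : Fin 2)))

theorem coeffwise_displacement_one (h : q * p = p * q + 1) :
    coeffwise (eulerFamily 1) (formalExp (displacementExponent p q)) =
      (-(MvPowerSeries.X 1 * MvPowerSeries.C q) +
        (1 / 2 : ℂ) • (MvPowerSeries.X 0 * MvPowerSeries.X 1)) *
          formalExp (displacementExponent p q) := by
  refine coeffwise_formalExp (isLeibniz_eulerFamily 1) (constantCoeff_displacementExponent p q)
    ?_ ?_ ?_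
  · rw [displacementExponent, map_sub, coeffwise_mul (isLeibniz_eulerFamily 1),
      coeffwise_mul (isLeibniz_eulerFamily 1)]
    simp [coeffwise_euler_X, coeffwise_euler_C]
  · have h0 := commute_X_left (A := A) (0 : Fin 2)
    have h1 := commute_X_left (A := A) (1 : Fin 2)
    rw [displacementExponent, sub_mul, mul_sub, neg_mul, mul_neg, mul_neg, neg_mul,
      central_mul_mul_central_mul h1, central_mul_mul_central_mul h0, C_mul_C_of_ccr h,
      (h1 (.X 0)).eq]
    noncomm_ring
  · exact Commute.mul_right (MvPowerSeries.commute_X _ (0 : Fin 2))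
      (MvPowerSeries.commute_X _ (1 : Fin 2))

/-- The deformation factor contributes -s/2 and the commutator -1/2 to the coefficient of ββ*. For
β* the commutator has the opposite sign, whence (1 - s)/2. -/
theorem coeffwise_orderedDisplacement_zero (h : q * p = p * q + 1) (s : ℂ) :
    coeffwise (eulerFamily 0) (orderedDisplacement s p q) =
      MvPowerSeries.X 0 * (MvPowerSeries.C p * orderedDisplacement s p q +
        (-(1 + s) / 2) • (MvPowerSeries.X 1 * orderedDisplacement s p q)) := by
  have hG := fun V : MvPowerSeries (Fin 2) A => commute_formalExp (constantCoeff_orderingExponent s)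
    (commute_orderingExponent s V)
  rw [orderedDisplacement, coeffwise_mul (isLeibniz_eulerFamily 0), coeffwise_ordering,
    coeffwise_displacement_zero h, ← mul_assoc (formalExp _), ← (hG _).eq]
  generalize formalExp (displacementExponent p q) = E
  generalize formalExp (orderingExponent A s) = G
  rw [orderingExponent, mul_neg]
  simp only [add_mul, mul_add, smul_mul_assoc, mul_smul_comm, neg_mul, smul_neg, mul_assoc]
  module

theorem coeffwise_orderedDisplacement_one (h : q * p = p * q + 1) (s : ℂ) :
    coeffwise (eulerFamily 1) (orderedDisplacement s p q) =
      MvPowerSeries.X 1 * (-(MvPowerSeries.C q * orderedDisplacement s p q) +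
        ((1 - s) / 2) • (MvPowerSeries.X 0 * orderedDisplacement s p q)) := by
  have hG := fun V : MvPowerSeries (Fin 2) A => commute_formalExp (constantCoeff_orderingExponent s)
    (commute_orderingExponent s V)
  rw [orderedDisplacement, coeffwise_mul (isLeibniz_eulerFamily 1), coeffwise_ordering,
    coeffwise_displacement_one h, ← mul_assoc (formalExp _), ← (hG _).eq]
  generalize formalExp (displacementExponent p q) = E
  generalize formalExp (orderingExponent A s) = G
  rw [orderingExponent, (commute_X_left (A := A) (0 : Fin 2) (.X 1)).eq,
    mul_neg (MvPowerSeries.X 0 : MvPowerSeries (Fin 2) A),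
    (commute_X_left (A := A) (0 : Fin 2) (.X 1)).eq]
  simp only [add_mul, mul_add, smul_mul_assoc, mul_smul_comm, mul_neg, neg_mul, smul_neg, mul_assoc]
  module

open Finsupp in
theorem coeff_orderedDisplacement_add_zero (h : q * p = p * q + 1) (s : ℂ) (d : Fin 2 →₀ ℕ) :
    p * MvPowerSeries.coeff d (orderedDisplacement s p q) =
      ((d 0 : ℂ) + 1) • MvPowerSeries.coeff (d + single 0 1) (orderedDisplacement s p q) +
      ((1 + s) / 2) • MvPowerSeries.coeff d (MvPowerSeries.X 1 * orderedDisplacement s p q) := by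
  have h := congrArg (MvPowerSeries.coeff (single 0 1 + d)) (coeffwise_orderedDisplacement_zero h s)
  rw [coeff_coeffwise, MvPowerSeries.X_def (0 : Fin 2), MvPowerSeries.coeff_add_monomial_mul, one_mul,
    map_add, MvPowerSeries.coeff_C_mul, coeff_complex_smul, add_comm (single 0 1)] at h
  simp only [eulerFamily, LinearMap.smul_apply, LinearMap.id_apply, Finsupp.add_apply,
    single_eq_same] at h
  push_cast at h
  rw [h]
  module

open Finsupp in
theorem coeff_orderedDisplacement_add_one (h : q * p = p * q + 1) (s : ℂ) (d : Fin 2 →₀ ℕ) :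
    q * MvPowerSeries.coeff d (orderedDisplacement s p q) =
      -((d 1 : ℂ) + 1) • MvPowerSeries.coeff (d + single 1 1) (orderedDisplacement s p q) +
      ((1 - s) / 2) • MvPowerSeries.coeff d (MvPowerSeries.X 0 * orderedDisplacement s p q) := by
  have h := congrArg (MvPowerSeries.coeff (single 1 1 + d)) (coeffwise_orderedDisplacement_one h s)
  rw [coeff_coeffwise, MvPowerSeries.X_def (1 : Fin 2), MvPowerSeries.coeff_add_monomial_mul, one_mul,
    map_add, map_neg, MvPowerSeries.coeff_C_mul, coeff_complex_smul, add_comm (single 1 1)] at h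
  simp only [eulerFamily, LinearMap.smul_apply, LinearMap.id_apply, Finsupp.add_apply,
    single_eq_same] at h
  push_cast at h
  rw [neg_smul ((d 1 : ℂ) + 1), h]
  module

end Displacement

theorem displacementS_eq (s : ℂ) : displacementS s = orderedDisplacement s ad a := rfl

open Finsupp in
theorem coeff_X_mul_add {σ A : Type} [Ring A] (i : σ) (d : σ →₀ ℕ) (f : MvPowerSeries σ A) :
    MvPowerSeries.coeff (d + single i 1) (MvPowerSeries.X i * f) = MvPowerSeries.coeff d f := by
  rw [add_comm, MvPowerSeries.X_def, MvPowerSeries.coeff_add_monomial_mul, one_mul]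

theorem coeff_X_mul_of_eq_zero {σ A : Type} [Ring A] {i : σ} {d : σ →₀ ℕ} (h : d i = 0)
    (f : MvPowerSeries σ A) : MvPowerSeries.coeff d (MvPowerSeries.X i * f) = 0 := by
  classical
  rw [MvPowerSeries.X_def, MvPowerSeries.coeff_monomial_mul, if_neg]
  intro hle
  have := hle i
  simp [h] at this

theorem eq_add_single_of_ne_zero {σ : Type} {i : σ} {d : σ →₀ ℕ} (h : d i ≠ 0) :
    d = (d - Finsupp.single i 1) + Finsupp.single i 1 :=
  (tsub_add_cancel_of_le (Finsupp.single_le_iff.mpr (Nat.one_le_iff_ne_zero.mpr h))).symm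

theorem quantize_monomial (s : ℂ) (d : Fin 2 →₀ ℕ) (r : ℂ) :
    quantize s (MvPolynomial.monomial d r) =
      (r * ((-1 : ℂ) ^ (d 1) * (Nat.factorial (d 0) : ℂ) * (Nat.factorial (d 1) : ℂ))) •
        MvPowerSeries.coeff d (displacementS s) := by
  have h : MvPolynomial.monomial d r = r • MvPolynomial.basisMonomials (Fin 2) ℂ d := by
    simp [MvPolynomial.smul_monomial]
  rw [h, map_smul, quantize, Module.Basis.constr_basis, smul_smul]

/-- Left multiplication by `a†` in terms of `s`-ordered symbols. -/
theorem ad_mul_quantize (s : ℂ) (F : Classical) :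
    ad * quantize s F =
      quantize s (αstar * F + (-(1 + s) / 2) • MvPolynomial.pderiv 1 F) := by
  induction F using MvPolynomial.induction_on' with
  | add p q hp hq =>
    rw [map_add, mul_add, hp, hq, ← map_add, mul_add, map_add (MvPolynomial.pderiv _), smul_add]
    congr 1
    abel
  | monomial d r =>
    rw [αstar, MvPolynomial.X, MvPolynomial.monomial_mul, MvPolynomial.pderiv_monomial, map_add,
      map_smul, quantize_monomial, quantize_monomial, quantize_monomial, mul_smul_comm, displacementS_eq,
      coeff_orderedDisplacement_add_zero a_mul_ad, add_comm (Finsupp.single 0 1) d]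
    -- If `d 1 = 0`, both the derivative and the `X 1` term vanish. Otherwise splitting off one unit
    -- removes the truncated subtraction.
    rcases Nat.eq_zero_or_pos (d 1) with h | h
    · rw [coeff_X_mul_of_eq_zero h]
      simp [h, Nat.factorial_succ, smul_smul]
      congr 1
      ring
    · obtain ⟨e, rfl⟩ : ∃ e, d = e + Finsupp.single 1 1 := ⟨_, eq_add_single_of_ne_zero h.ne'⟩
      rw [coeff_X_mul_add]
      simp [Nat.factorial_succ, smul_smul]
      module

/-- Left multiplication by `a` in terms of `s`-ordered symbols. -/
theorem a_mul_quantize (s : ℂ) (F : Classical) :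
    a * quantize s F =
      quantize s (α * F + ((1 - s) / 2) • MvPolynomial.pderiv 0 F) := by
  induction F using MvPolynomial.induction_on' with
  | add p q hp hq =>
    rw [map_add, mul_add, hp, hq, ← map_add, mul_add, map_add (MvPolynomial.pderiv _), smul_add]
    congr 1
    abel
  | monomial d r =>
    rw [α, MvPolynomial.X, MvPolynomial.monomial_mul, MvPolynomial.pderiv_monomial, map_add,
      map_smul, quantize_monomial, quantize_monomial, quantize_monomial, mul_smul_comm, displacementS_eq,
      coeff_orderedDisplacement_add_one a_mul_ad, add_comm (Finsupp.single 1 1) d]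
    rcases Nat.eq_zero_or_pos (d 0) with h | h
    · rw [coeff_X_mul_of_eq_zero h]
      simp [h, Nat.factorial_succ, smul_smul, pow_succ]
      module
    · obtain ⟨e, rfl⟩ : ∃ e, d = e + Finsupp.single 0 1 := ⟨_, eq_add_single_of_ne_zero h.ne'⟩
      rw [coeff_X_mul_add]
      simp [Nat.factorial_succ, smul_smul, pow_succ]
      module

theorem quantize_one (s : ℂ) : quantize s 1 = 1 := by
  rw [← MvPolynomial.C_1, ← MvPolynomial.monomial_zero', quantize_monomial, displacementS,
    displacement]
  simp [MvPowerSeries.coeff_mul, coeff_zero_formalExp]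

/-! ### The scalar series -/

/-- The constant series `-(1 + s) / 2`. -/
def lowerC (s : ℂ) : ℂ⟦X⟧ := C (-(1 + s) / 2)

/-- The constant series `(1 - s) / 2`. -/
def upperC (s : ℂ) : ℂ⟦X⟧ := C ((1 - s) / 2)

/-- Together with `C_eq` this expresses s and d through c alone, which makes the later identities
polynomial in one parameter. -/
theorem upperC_eq (s : ℂ) : upperC s = lowerC s + 1 := by
  rw [upperC, lowerC, ← map_one (C : ℂ →+* ℂ⟦X⟧), ← map_add]
  congr 1
  ring

theorem C_eq (s : ℂ) : (C s : ℂ⟦X⟧) = -(2 * lowerC s + 1) := by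
  rw [lowerC, ← map_one (C : ℂ →+* ℂ⟦X⟧), ← map_ofNat (C : ℂ →+* ℂ⟦X⟧) 2, ← map_mul, ← map_add,
    ← map_neg]
  congr 1
  ring

theorem constantCoeff_quad (s : ℂ) : constantCoeff (quad s) = 1 := by simp [quad]

theorem root_sq (s : ℂ) : root s ^ 2 = 1 + 2 * C s * X + X ^ 2 := by
  rw [root, formalSqrt_sq (constantCoeff_quad s), quad, map_mul, map_ofNat]

theorem constantCoeff_root (s : ℂ) : constantCoeff (root s) = 1 :=
  constantCoeff_formalSqrt (constantCoeff_quad s)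

theorem expo_mul (s : ℂ) : expo s * (1 + C s * X + root s) = 2 * X := by
  rw [expo, mul_assoc, PowerSeries.inv_mul_cancel, mul_one, map_ofNat]
  rw [map_add, map_add, constantCoeff_root]
  norm_num

theorem ne_zero_of_constantCoeff {f : ℂ⟦X⟧} (h : constantCoeff f ≠ 0) : f ≠ 0 := by
  rintro rfl
  simp at h

theorem expo_denominator_ne_zero (s : ℂ) : (1 + C s * X + root s) ≠ 0 := by
  apply ne_zero_of_constantCoeff
  rw [map_add, map_add, constantCoeff_root]
  norm_num

theorem constantCoeff_expo (s : ℂ) : constantCoeff (expo s) = 0 := by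
  simp [expo]

/-- The algebraic equation of the exponent. -/
theorem expo_algebraic (s : ℂ) :
    X * (1 + lowerC s * expo s) * (1 + upperC s * expo s) = expo s := by
  have hK := expo_mul s
  have hr := root_sq s
  have h0 := expo_denominator_ne_zero s
  rw [C_eq] at hK hr h0
  rw [upperC_eq]
  generalize lowerC s = c at *
  generalize root s = r at *
  generalize expo s = e at *
  generalize (X : ℂ⟦X⟧) = x at *
  generalize hk : 1 + -(2 * c + 1) * x + r = K at *
  -- This is (K - 1 - sx)² = r² expanded, using s² - 1 = 4c(c + 1). The claim times K², with eK =
  -- 2x, is x times this quadratic.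
  have hK2 : K ^ 2 = 2 * K - 2 * (2 * c + 1) * x * K - 4 * c * (c + 1) * x ^ 2 := by
    subst hk
    linear_combination hr
  apply mul_right_cancel₀ (pow_ne_zero 2 h0)
  linear_combination (x * c * (K + (c + 1) * (e * K + 2 * x)) + x * (c + 1) * K - K) * hK + x * hK2

/-- The algebraic equation is a quadratic in e with discriminant `root s ^ 2`, and e is its root
vanishing at 0. So r = 1 - (c + d)x - 2cdxe, hence re = x(1 - cde²). -/
theorem root_mul (s : ℂ) :
    root s * ((1 + lowerC s * expo s) * (1 + upperC s * expo s)) =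
      1 - lowerC s * upperC s * expo s ^ 2 := by
  have hK := expo_mul s
  have hr := root_sq s
  have h0 := expo_denominator_ne_zero s
  rw [C_eq] at hK hr h0
  rw [upperC_eq]
  generalize lowerC s = c at *
  generalize root s = r at *
  generalize expo s = e at *
  generalize (X : ℂ⟦X⟧) = x at *
  generalize hk : 1 + -(2 * c + 1) * x + r = K at *
  have hK2 : K ^ 2 = 2 * K - 2 * (2 * c + 1) * x * K - 4 * c * (c + 1) * x ^ 2 := by
    subst hk
    linear_combination hr
  obtain rfl : r = K - (1 - (2 * c + 1) * x) := by rw [← hk]; ring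
  apply mul_right_cancel₀ (pow_ne_zero 2 h0)
  linear_combination ((K - (1 - (2 * c + 1) * x)) * ((2 * c + 1) * K + c * (c + 1) * (e * K + 2 * x)) +
    c * (c + 1) * (e * K + 2 * x)) * hK + (K - (1 - (2 * c + 1) * x) + 1) * hK2

/-- The differential equation of the exponent. -/
theorem derivative_expo (s : ℂ) :
    d⁄dX ℂ (expo s) * (1 - lowerC s * upperC s * expo s ^ 2) =
      (1 + lowerC s * expo s) ^ 2 * (1 + upperC s * expo s) ^ 2 := by
  have h := expo_algebraic s
  -- Implicit differentiation; multiplying by (1 + ce)(1 + de) then lets `h` eliminate X.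
  have h' := congrArg (d⁄dX ℂ) h
  rw [Derivation.leibniz, Derivation.leibniz, map_add, map_add, Derivation.leibniz,
    Derivation.leibniz, derivative_one, derivative_X, lowerC, upperC, derivative_C, derivative_C] at h'
  rw [lowerC, upperC] at h ⊢
  simp only [smul_eq_mul] at h'
  generalize d⁄dX ℂ (expo s) = e' at *
  generalize expo s = e at *
  generalize C (-(1 + s) / 2) = c at *
  generalize C ((1 - s) / 2) = d at *
  linear_combination -((1 + c * e) * (1 + d * e)) * h' + e' * (c + d + 2 * c * d * e) * h

/-- The logarithmic derivative of p = q/(1 - cde²), cleared of denominators. `hq` is the logarithmic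
derivative of the numerator q, and `hp'` is the differentiated `hp`. -/
theorem prefactor_equation {R : Type} [CommRing R] [IsDomain R] {x c d e e' k p p' q q' : R}
    (hd : d = c + 1) (h : x * (1 + c * e) * (1 + d * e) = e)
    (he : e' * (1 - c * d * e ^ 2) = (1 + c * e) ^ 2 * (1 + d * e) ^ 2)
    (hp : p * (1 - c * d * e ^ 2) = q)
    (hp' : p' * (1 - c * d * e ^ 2) - 2 * c * d * e * e' * p = q')
    (hq : (1 + c * e) * (1 + d * e) * q' = e' * (2 * c * (1 + d * e) + k) * q)
    (hN : 1 - c * d * e ^ 2 ≠ 0) (hC : 1 + c * e ≠ 0) (hD : 1 + d * e ≠ 0) :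
    p' = (1 + c * e) ^ 2 * (d * x * p') +
      2 * c * (1 + c * e) * p * (1 + d * (e + x * e')) + k * (1 + c * e) * p := by
  subst hd
  -- The equation of the exponent in the form produced by the ladder operators.
  have h1 : (1 + c * e) ^ 2 * (1 + (c + 1) * (e + x * e')) = e' := by
    apply mul_right_cancel₀ hD
    linear_combination (c + 1) * e' * (1 + c * e) * h - he
  have h2 : p' * (1 + c * e) * (1 - c * (c + 1) * e ^ 2) =
      (2 * c * (1 + (c + 1) * e) * e' + k * (1 + c * e) ^ 2 * (1 + (c + 1) * e)) * p := by
    apply mul_left_cancel₀ (mul_ne_zero hN hD)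
    linear_combination (1 - c * (c + 1) * e ^ 2) * (1 + (c + 1) * e) * (1 + c * e) * hp' +
      (1 - c * (c + 1) * e ^ 2) * hq -
      (1 - c * (c + 1) * e ^ 2) * e' * (2 * c * (1 + (c + 1) * e) + k) * hp +
      (1 - c * (c + 1) * e ^ 2) * p * k * he
  apply mul_left_cancel₀ (mul_ne_zero hC hD)
  linear_combination h2 - 2 * c * p * (1 + (c + 1) * e) * h1 - p' * (c + 1) * (1 + c * e) ^ 2 * h

/-- The product `(1 + c e) ^ j (1 + d e) ^ k / (1 - c d e ^ 2)`, with `c = -(1 + s) / 2`,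
`d = (1 - s) / 2` and `e` the exponent. -/
def prefactor (s : ℂ) (j k : ℕ) : ℂ⟦X⟧ :=
  (1 + lowerC s * expo s) ^ j * (1 + upperC s * expo s) ^ k *
    (1 - lowerC s * upperC s * expo s ^ 2)⁻¹

theorem prefactor_denominator_ne_zero (s : ℂ) :
    constantCoeff (1 - lowerC s * upperC s * expo s ^ 2) ≠ 0 := by
  simp [constantCoeff_expo]

theorem one_add_lowerC_mul_expo_ne_zero (s : ℂ) : 1 + lowerC s * expo s ≠ 0 :=
  ne_zero_of_constantCoeff (by simp [constantCoeff_expo])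

theorem one_add_upperC_mul_expo_ne_zero (s : ℂ) : 1 + upperC s * expo s ≠ 0 :=
  ne_zero_of_constantCoeff (by simp [constantCoeff_expo])

theorem prefactor_mul (s : ℂ) (j k : ℕ) :
    prefactor s j k * (1 - lowerC s * upperC s * expo s ^ 2) =
      (1 + lowerC s * expo s) ^ j * (1 + upperC s * expo s) ^ k := by
  rw [prefactor, mul_assoc, PowerSeries.inv_mul_cancel _ (prefactor_denominator_ne_zero s), mul_one]

theorem constantCoeff_prefactor (s : ℂ) (j k : ℕ) : constantCoeff (prefactor s j k) = 1 := by
  have := congrArg constantCoeff (prefactor_mul s j k)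
  simpa [constantCoeff_expo] using this

/-- With j = 2 - k, jc(1 + de) + kd(1 + ce) collapses to 2c(1 + de) + k because d - c = 1. -/
theorem derivative_numerator (s : ℂ) {j k : ℕ} (hjk : j + k = 2) :
    (1 + lowerC s * expo s) * (1 + upperC s * expo s) *
      d⁄dX ℂ ((1 + lowerC s * expo s) ^ j * (1 + upperC s * expo s) ^ k) =
      d⁄dX ℂ (expo s) * (2 * lowerC s * (1 + upperC s * expo s) + k) *
        ((1 + lowerC s * expo s) ^ j * (1 + upperC s * expo s) ^ k) := by
  have hC' : d⁄dX ℂ (1 + lowerC s * expo s) = lowerC s * d⁄dX ℂ (expo s) := by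
    have hlc : d⁄dX ℂ (lowerC s) = 0 := derivative_C
    rw [map_add, derivative_one, Derivation.leibniz, hlc, smul_zero, smul_eq_mul]; ring
  have hD' : d⁄dX ℂ (1 + upperC s * expo s) = upperC s * d⁄dX ℂ (expo s) := by
    have huc : d⁄dX ℂ (upperC s) = 0 := derivative_C
    rw [map_add, derivative_one, Derivation.leibniz, huc, smul_zero, smul_eq_mul]; ring
  rw [Derivation.leibniz, Derivation.leibniz_pow, Derivation.leibniz_pow, hC', hD', upperC_eq]
  generalize d⁄dX ℂ (expo s) = e'
  generalize expo s = e
  generalize lowerC s = c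
  obtain ⟨rfl, rfl⟩ | ⟨rfl, rfl⟩ | ⟨rfl, rfl⟩ :
      (j = 2 ∧ k = 0) ∨ (j = 1 ∧ k = 1) ∨ (j = 0 ∧ k = 2) := by omega
  all_goals
    simp only [smul_eq_mul, nsmul_eq_mul]
    push_cast
    ring

/-- The differential equation of the prefactors. -/
theorem derivative_prefactor (s : ℂ) {j k : ℕ} (hjk : j + k = 2) :
    d⁄dX ℂ (prefactor s j k) =
      (1 + lowerC s * expo s) ^ 2 * (upperC s * X * d⁄dX ℂ (prefactor s j k)) +
      2 * lowerC s * (1 + lowerC s * expo s) * prefactor s j k *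
        (1 + upperC s * (expo s + X * d⁄dX ℂ (expo s))) +
      (k : ℂ⟦X⟧) * (1 + lowerC s * expo s) * prefactor s j k := by
  have h := expo_algebraic s
  have he := derivative_expo s
  have hp := prefactor_mul s j k
  have hp' := congrArg (d⁄dX ℂ) hp
  have hN := ne_zero_of_constantCoeff (prefactor_denominator_ne_zero s)
  have hc := one_add_lowerC_mul_expo_ne_zero s
  have hd := one_add_upperC_mul_expo_ne_zero s
  have hlc : d⁄dX ℂ (lowerC s) = 0 := derivative_C
  have huc : d⁄dX ℂ (upperC s) = 0 := derivative_C
  have hdc : upperC s = lowerC s + 1 := upperC_eq s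
  rw [Derivation.leibniz] at hp'
  have hN' : d⁄dX ℂ (1 - lowerC s * upperC s * expo s ^ 2) =
      -(2 * lowerC s * upperC s * expo s * d⁄dX ℂ (expo s)) := by
    simp only [Derivation.leibniz, Derivation.leibniz_pow, map_sub, derivative_one, hlc, huc,
      smul_eq_mul, nsmul_eq_mul]
    push_cast
    ring
  rw [hN', smul_eq_mul, smul_eq_mul] at hp'
  refine prefactor_equation hdc h he hp ?_ (derivative_numerator s hjk) hN hc hd
  rw [← hp']
  ring

/-! ### Identification of the stated prefactors -/

theorem root_ne_zero (s : ℂ) : root s ≠ 0 :=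
  ne_zero_of_constantCoeff (by simp [constantCoeff_root])

theorem quad_eq (s : ℂ) : quad s = root s ^ 2 := by
  rw [root_sq, quad, map_mul, map_ofNat]

theorem prefactor11_eq (s : ℂ) : prefactor11 s = prefactor s 1 1 := by
  apply mul_right_cancel₀ (root_ne_zero s)
  rw [prefactor11, PowerSeries.inv_mul_cancel _ (by simp [constantCoeff_root])]
  apply mul_right_cancel₀ (ne_zero_of_constantCoeff (prefactor_denominator_ne_zero s))
  linear_combination -root_mul s - root s * prefactor_mul s 1 1

/-- Since s = -(c + d) and d - c = 1, the left side becomes a perfect square times -2c = 1 + s. This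
factor cancels the numerator of `prefactor20`, whose denominator is root · (root + X + s), so the
singularity at s = -1 is removable. -/
theorem root_add_mul (s : ℂ) :
    (root s + X + C s) * ((1 + lowerC s * expo s) * (1 + upperC s * expo s)) =
      -2 * lowerC s * (1 + upperC s * expo s) ^ 2 := by
  have h := expo_algebraic s
  have hr := root_mul s
  rw [C_eq]
  rw [upperC_eq] at *
  linear_combination hr + h

theorem root_sub_mul (s : ℂ) :
    (root s - X - C s) * ((1 + lowerC s * expo s) * (1 + upperC s * expo s)) =
      2 * upperC s * (1 + lowerC s * expo s) ^ 2 := by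
  have h := expo_algebraic s
  have hr := root_mul s
  rw [C_eq]
  rw [upperC_eq] at *
  linear_combination hr - h

theorem prefactor20_eq {s : ℂ} (hs : s ≠ -1) : prefactor20 s = prefactor s 2 0 := by
  have h0 : constantCoeff (quad s + (X + C s) * root s) ≠ 0 := by
    simpa [constantCoeff_quad, constantCoeff_root] using fun h => hs (eq_neg_of_add_eq_zero_right h)
  have hC : (C (1 + s) : ℂ⟦X⟧) = -2 * lowerC s := by
    rw [map_add, map_one, C_eq]; ring
  rw [prefactor20, eq_comm, PowerSeries.eq_mul_inv_iff_mul_eq h0, hC, quad_eq]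
  apply mul_right_cancel₀ (mul_ne_zero (ne_zero_of_constantCoeff (prefactor_denominator_ne_zero s))
    (pow_ne_zero 2 (one_add_upperC_mul_expo_ne_zero s)))
  have h1 := prefactor_mul s 2 0
  have h2 := root_mul s
  have h3 := root_add_mul s
  linear_combination root s * (root s + X + C s) * (1 + upperC s * expo s) ^ 2 * h1 +
    (root s + X + C s) * ((1 + lowerC s * expo s) * (1 + upperC s * expo s)) * h2 +
    (1 - lowerC s * upperC s * expo s ^ 2) * h3

theorem prefactor02_eq {s : ℂ} (hs : s ≠ 1) : prefactor02 s = prefactor s 0 2 := by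
  have h0 : constantCoeff (quad s - (X + C s) * root s) ≠ 0 := by
    simpa [constantCoeff_quad, constantCoeff_root] using sub_ne_zero.mpr hs.symm
  have hC : (C (1 - s) : ℂ⟦X⟧) = 2 * upperC s := by
    rw [map_sub, map_one, C_eq, upperC_eq]; ring
  rw [prefactor02, eq_comm, PowerSeries.eq_mul_inv_iff_mul_eq h0, hC, quad_eq]
  apply mul_right_cancel₀ (mul_ne_zero (ne_zero_of_constantCoeff (prefactor_denominator_ne_zero s))
    (pow_ne_zero 2 (one_add_lowerC_mul_expo_ne_zero s)))
  have h1 := prefactor_mul s 0 2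
  have h2 := root_mul s
  have h3 := root_sub_mul s
  linear_combination root s * (root s - X - C s) * (1 + lowerC s * expo s) ^ 2 * h1 +
    (root s - X - C s) * ((1 + lowerC s * expo s) * (1 + upperC s * expo s)) * h2 +
    (1 - lowerC s * upperC s * expo s ^ 2) * h3

/-- Here c = 0, so numerator and denominator of the regular form are both 1. -/
theorem prefactor_two_zero_neg_one : prefactor (-1) 2 0 = 1 := by
  have h := prefactor_mul (-1) 2 0
  have h0 : lowerC (-1) = 0 := by simp [lowerC]
  simpa [h0] using h

theorem prefactor_zero_two_one : prefactor 1 0 2 = 1 := by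
  have h := prefactor_mul 1 0 2
  have h0 : upperC 1 = 0 := by simp [upperC]
  simpa [h0] using h

/-! ### Continuity of the coefficients in the ordering parameter -/

/-- All coefficients below `n` depend continuously on the parameter. -/
def ContinuousBelow (n : ℕ) (f : ℂ → ℂ⟦X⟧) : Prop :=
  ∀ m < n, Continuous fun s => coeff m (f s)

theorem ContinuousBelow.mul {n : ℕ} {f g : ℂ → ℂ⟦X⟧} (hf : ContinuousBelow n f)
    (hg : ContinuousBelow n g) : ContinuousBelow n fun s => f s * g s := by
  intro m hm
  simp only [PowerSeries.coeff_mul]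
  refine continuous_finsetSum _ fun p hp => ?_
  have := Finset.HasAntidiagonal.mem_antidiagonal.mp hp
  exact (hf _ (by omega)).mul (hg _ (by omega))

/-- The gain of one order drives the inductions on fixed-point equations below. -/
theorem ContinuousBelow.X_mul {n : ℕ} {f : ℂ → ℂ⟦X⟧} (hf : ContinuousBelow n f) :
    ContinuousBelow (n + 1) fun s => X * f s := by
  intro m hm
  cases m with
  | zero => simpa using continuous_const
  | succ m => simpa [coeff_succ_X_mul] using hf m (by omega)

theorem ContinuousBelow.add {n : ℕ} {f g : ℂ → ℂ⟦X⟧} (hf : ContinuousBelow n f)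
    (hg : ContinuousBelow n g) : ContinuousBelow n fun s => f s + g s := by
  intro m hm
  simp only [map_add]
  exact (hf m hm).add (hg m hm)

theorem continuousBelow_C {n : ℕ} {f : ℂ → ℂ} (hf : Continuous f) :
    ContinuousBelow n fun s => C (f s) := by
  intro m _
  simp only [coeff_C]
  split_ifs
  exacts [hf, continuous_const]

theorem continuousBelow_one {n : ℕ} : ContinuousBelow n fun _ => 1 := fun _ _ => continuous_const

theorem continuousBelow_lowerC {n : ℕ} : ContinuousBelow n lowerC :=
  continuousBelow_C (by fun_prop)

theorem continuousBelow_upperC {n : ℕ} : ContinuousBelow n upperC :=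
  continuousBelow_C (by fun_prop)

/-- In e = X(1 + ce)(1 + de) each coefficient of e depends on lower ones only, so the square root
need not be examined. -/
theorem continuousBelow_expo (n : ℕ) : ContinuousBelow n expo := by
  induction n with
  | zero => intro m hm; omega
  | succ n ih =>
    have h := ((continuousBelow_one.add (continuousBelow_lowerC.mul ih)).mul
      (continuousBelow_one.add (continuousBelow_upperC.mul ih))).X_mul
    simpa only [← mul_assoc, expo_algebraic] using h

/-- The inverse p of 1 - cde² satisfies p = 1 + cde²p. Replacing one factor e by X(1 + ce)(1 + de)
exposes the X that the induction needs. -/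
theorem continuousBelow_prefactor_zero (n : ℕ) : ContinuousBelow n fun s => prefactor s 0 0 := by
  induction n with
  | zero => intro m hm; omega
  | succ n ih =>
    have he := continuousBelow_expo n
    have h1 := (continuousBelow_one.add (continuousBelow_lowerC.mul he)).mul
      (continuousBelow_one.add (continuousBelow_upperC.mul he))
    have h := (continuousBelow_one (n := n + 1)).add
      ((((continuousBelow_lowerC.mul continuousBelow_upperC).mul he).mul (h1.mul ih)).X_mul)
    convert h using 2 with s
    have h2 := prefactor_mul s 0 0
    rw [pow_zero, pow_zero, one_mul] at h2
    linear_combination h2 - lowerC s * upperC s * expo s * prefactor s 0 0 * expo_algebraic s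

theorem continuousBelow_pow {n : ℕ} {f : ℂ → ℂ⟦X⟧} (hf : ContinuousBelow n f) (k : ℕ) :
    ContinuousBelow n fun s => f s ^ k := by
  induction k with
  | zero => simpa using continuousBelow_one
  | succ k ih => simpa only [pow_succ] using ih.mul hf

theorem continuous_coeff_prefactor (j k n : ℕ) :
    Continuous fun s => coeff n (prefactor s j k) := by
  have he := continuousBelow_expo (n + 1)
  have h := ((continuousBelow_pow (continuousBelow_one.add (continuousBelow_lowerC.mul he)) j).mul
    (continuousBelow_pow (continuousBelow_one.add (continuousBelow_upperC.mul he)) k)).mul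
      (continuousBelow_prefactor_zero (n + 1)) n n.lt_succ_self
  simpa [prefactor] using h

theorem tendsto_coeff_prefactor20 (n : ℕ) :
    Tendsto (fun s : ℂ => coeff n (prefactor20 s)) (𝓝[≠] (-1)) (𝓝 (coeff n (1 : ℂ⟦X⟧))) := by
  rw [← prefactor_two_zero_neg_one]
  refine Tendsto.congr' ?_ ((continuous_coeff_prefactor 2 0 n).continuousAt.tendsto.mono_left
    nhdsWithin_le_nhds)
  filter_upwards [self_mem_nhdsWithin] with s hs
  rw [prefactor20_eq hs]

theorem tendsto_coeff_prefactor02 (n : ℕ) :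
    Tendsto (fun s : ℂ => coeff n (prefactor02 s)) (𝓝[≠] 1) (𝓝 (coeff n (1 : ℂ⟦X⟧))) := by
  rw [← prefactor_zero_two_one]
  refine Tendsto.congr' ?_ ((continuous_coeff_prefactor 0 2 n).continuousAt.tendsto.mono_left
    nhdsWithin_le_nhds)
  filter_upwards [self_mem_nhdsWithin] with s hs
  rw [prefactor02_eq hs]

/-! ### The exponential of an operator -/

/-- The exponent λω is its own Euler derivative, so no commutator term arises. -/
theorem coeffwise_euler_expOp {A : Type} [Ring A] [Algebra ℂ A] (ω : A) (n : ℕ) :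
    ((n : ℂ) + 1) • coeff (n + 1) (formalExp (X * C ω : A⟦X⟧)) =
      ω * coeff n (formalExp (X * C ω : A⟦X⟧)) := by
  have hF : MvPowerSeries.constantCoeff (X * C ω : A⟦X⟧) = 0 := by
    change constantCoeff (X * C ω : A⟦X⟧) = 0
    simp
  have hZ : coeffwise (eulerFamily ()) (X * C ω : A⟦X⟧) = X * C ω := by
    rw [coeffwise_mul (isLeibniz_eulerFamily ()), PowerSeries.X, PowerSeries.C, coeffwise_euler_X,
      coeffwise_euler_C, if_pos rfl, mul_zero, add_zero]
  have h := coeffwise_formalExp (isLeibniz_eulerFamily ()) hF hZ (W := 0) (by simp)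
    (Commute.zero_right _)
  have h2 := congrArg (coeff (n + 1)) h
  rw [smul_zero, add_zero, mul_assoc, coeff_succ_X_mul, coeff_C_mul] at h2
  rw [← h2]
  change _ = (((Finsupp.single () (n + 1)) () : ℕ) : ℂ) • coeff (n + 1) (formalExp (X * C ω : A⟦X⟧))
  rw [Finsupp.single_eq_same]
  push_cast
  rfl

theorem coeff_zero_formalExp_powerSeries {A : Type} [Ring A] [Algebra ℂ A] (F : A⟦X⟧) :
    coeff 0 (formalExp F) = 1 := by
  rw [coeff, Finsupp.single_zero]
  exact coeff_zero_formalExp F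

/-! ### Derivatives of the classical series -/

/-- Partial derivative of the coefficients. -/
def coeffPderiv (i : Fin 2) : Classical⟦X⟧ →ₗ[ℂ] Classical⟦X⟧ :=
  coeffwise fun _ => (MvPolynomial.pderiv i : Derivation ℂ Classical Classical).toLinearMap

/-- The operator `λ ∂_λ`. -/
def euler : Classical⟦X⟧ →ₗ[ℂ] Classical⟦X⟧ := coeffwise (eulerFamily ())

theorem isLeibniz_pderiv (i : Fin 2) : IsLeibniz (σ := Unit) fun _ =>
    (MvPolynomial.pderiv i : Derivation ℂ Classical Classical).toLinearMap := by
  intro d e x y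
  simp only [Derivation.coeFn_coe, Derivation.leibniz, smul_eq_mul]
  ring

theorem coeff_coeffPderiv (i : Fin 2) (f : Classical⟦X⟧) (n : ℕ) :
    coeff n (coeffPderiv i f) = MvPolynomial.pderiv i (coeff n f) := rfl

theorem coeff_euler (f : Classical⟦X⟧) (n : ℕ) : coeff n (euler f) = (n : ℂ) • coeff n f := by
  change (((Finsupp.single () n) () : ℕ) : ℂ) • coeff n f = _
  rw [Finsupp.single_eq_same]

theorem coeffPderiv_mul (i : Fin 2) (f g : Classical⟦X⟧) :
    coeffPderiv i (f * g) = coeffPderiv i f * g + f * coeffPderiv i g :=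
  coeffwise_mul (isLeibniz_pderiv i) f g

theorem euler_mul (f g : Classical⟦X⟧) : euler (f * g) = euler f * g + f * euler g :=
  coeffwise_mul (isLeibniz_eulerFamily ()) f g

theorem coeffPderiv_formalExp (i : Fin 2) {F : Classical⟦X⟧} (hF : constantCoeff F = 0) :
    coeffPderiv i (formalExp F) = coeffPderiv i F * formalExp F := by
  have h := coeffwise_formalExp (isLeibniz_pderiv i) hF rfl (W := 0)
    (by rw [add_zero, mul_comm]) (Commute.zero_right _)
  rw [smul_zero, add_zero] at h
  exact h

theorem euler_formalExp {F : Classical⟦X⟧} (hF : constantCoeff F = 0) :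
    euler (formalExp F) = euler F * formalExp F := by
  have h := coeffwise_formalExp (isLeibniz_eulerFamily ()) hF rfl (W := 0)
    (by rw [add_zero, mul_comm]) (Commute.zero_right _)
  rw [smul_zero, add_zero] at h
  exact h

theorem coeffPderiv_C (i : Fin 2) (f : Classical) :
    coeffPderiv i (C f) = C (MvPolynomial.pderiv i f) := by
  ext1 n
  rw [coeff_coeffPderiv, coeff_C, coeff_C]
  split_ifs <;> simp

theorem coeffPderiv_X (i : Fin 2) : coeffPderiv i (X : Classical⟦X⟧) = 0 := by
  ext1 n
  rw [coeff_coeffPderiv, coeff_X]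
  split_ifs <;> simp

theorem euler_C (f : Classical) : euler (C f) = 0 := by
  ext1 n
  rw [coeff_euler, coeff_C]
  split_ifs with h <;> simp [h]

/-- The substitution `z = λ α*` as a ring homomorphism. -/
def atLamAstarHom : ℂ⟦X⟧ →+* Classical⟦X⟧ :=
  (PowerSeries.rescale αstar).comp (PowerSeries.map MvPolynomial.C)

theorem atLamAstar_eq (φ : ℂ⟦X⟧) : atLamAstar φ = atLamAstarHom φ := by
  ext1 n
  simp [atLamAstar, atLamAstarHom, coeff_rescale, mul_comm]

theorem coeff_atLamAstarHom (φ : ℂ⟦X⟧) (n : ℕ) :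
    coeff n (atLamAstarHom φ) = MvPolynomial.C (coeff n φ) * αstar ^ n := by
  rw [← atLamAstar_eq, atLamAstar, coeff_mk]

theorem atLamAstarHom_X : atLamAstarHom X = X * C αstar := by
  simp [atLamAstarHom, rescale_X, mul_comm]

theorem atLamAstarHom_C (r : ℂ) : atLamAstarHom (C r) = C (MvPolynomial.C r) := by
  ext1 n
  rw [coeff_atLamAstarHom, coeff_C, coeff_C]
  split_ifs with h <;> simp [h]

theorem coeffPderiv_one_atLamAstarHom (φ : ℂ⟦X⟧) : coeffPderiv 1 (atLamAstarHom φ) = 0 := by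
  ext1 n
  rw [coeff_coeffPderiv, coeff_atLamAstarHom]
  simp [αstar, Derivation.leibniz_pow]

theorem coeffPderiv_zero_atLamAstarHom (φ : ℂ⟦X⟧) :
    coeffPderiv 0 (atLamAstarHom φ) = X * atLamAstarHom (d⁄dX ℂ φ) := by
  ext1 n
  rw [coeff_coeffPderiv, coeff_atLamAstarHom]
  cases n with
  | zero => simp
  | succ n =>
    rw [coeff_succ_X_mul, coeff_atLamAstarHom, coeff_derivative]
    simp [αstar, Derivation.leibniz_pow]
    ring

theorem euler_atLamAstarHom (φ : ℂ⟦X⟧) :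
    euler (atLamAstarHom φ) = X * C αstar * atLamAstarHom (d⁄dX ℂ φ) := by
  ext1 n
  rw [coeff_euler, coeff_atLamAstarHom, mul_assoc]
  cases n with
  | zero => simp
  | succ n =>
    rw [coeff_succ_X_mul, coeff_C_mul, coeff_atLamAstarHom, coeff_derivative,
      MvPolynomial.smul_eq_C_mul]
    simp
    ring

/-! ### The differential operators of the ladder operators -/

/-- The operator on classical series that represents left multiplication by `a†`. -/
def adSymbol (s : ℂ) (F : Classical⟦X⟧) : Classical⟦X⟧ :=
  C αstar * F + atLamAstarHom (lowerC s) * coeffPderiv 1 F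

/-- The operator on classical series that represents left multiplication by `a`. -/
def aSymbol (s : ℂ) (F : Classical⟦X⟧) : Classical⟦X⟧ :=
  C α * F + atLamAstarHom (upperC s) * coeffPderiv 0 F

theorem quantize_coeff_adSymbol (s : ℂ) (F : Classical⟦X⟧) (n : ℕ) :
    quantize s (coeff n (adSymbol s F)) = ad * quantize s (coeff n F) := by
  rw [ad_mul_quantize, adSymbol, lowerC, atLamAstarHom_C, map_add, coeff_C_mul, coeff_C_mul,
    coeff_coeffPderiv, MvPolynomial.smul_eq_C_mul]

theorem quantize_coeff_aSymbol (s : ℂ) (F : Classical⟦X⟧) (n : ℕ) :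
    quantize s (coeff n (aSymbol s F)) = a * quantize s (coeff n F) := by
  rw [a_mul_quantize, aSymbol, upperC, atLamAstarHom_C, map_add, coeff_C_mul, coeff_C_mul,
    coeff_coeffPderiv, MvPolynomial.smul_eq_C_mul]

theorem commonFactor_eq (s : ℂ) :
    commonFactor s = formalExp (C αstar * C α * atLamAstarHom (expo s)) := by
  rw [commonFactor, map_mul, atLamAstar_eq]

theorem constantCoeff_commonExponent (s : ℂ) :
    constantCoeff (C αstar * C α * atLamAstarHom (expo s)) = 0 := by
  have h : constantCoeff (atLamAstarHom (expo s)) = 0 := by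
    rw [← coeff_zero_eq_constantCoeff_apply, coeff_atLamAstarHom, coeff_zero_eq_constantCoeff_apply,
      constantCoeff_expo, map_zero, zero_mul]
  rw [map_mul, h, mul_zero]

theorem coeffPderiv_one_astar : coeffPderiv 1 (C αstar) = 0 := by
  rw [coeffPderiv_C, αstar, MvPolynomial.pderiv_X_of_ne (by decide), map_zero]

theorem coeffPderiv_one_alpha : coeffPderiv 1 (C α) = 1 := by
  rw [coeffPderiv_C, α, MvPolynomial.pderiv_X_self, map_one]

theorem coeffPderiv_zero_astar : coeffPderiv 0 (C αstar) = 1 := by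
  rw [coeffPderiv_C, αstar, MvPolynomial.pderiv_X_self, map_one]

theorem coeffPderiv_zero_alpha : coeffPderiv 0 (C α) = 0 := by
  rw [coeffPderiv_C, α, MvPolynomial.pderiv_X_of_ne (by decide), map_zero]

theorem coeffPderiv_one_commonFactor (s : ℂ) :
    coeffPderiv 1 (commonFactor s) = C αstar * atLamAstarHom (expo s) * commonFactor s := by
  rw [commonFactor_eq, coeffPderiv_formalExp 1 (constantCoeff_commonExponent s), coeffPderiv_mul,
    coeffPderiv_mul, coeffPderiv_one_astar, coeffPderiv_one_alpha, coeffPderiv_one_atLamAstarHom]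
  ring

theorem coeffPderiv_zero_commonFactor (s : ℂ) :
    coeffPderiv 0 (commonFactor s) =
      C α * (atLamAstarHom (expo s) + C αstar * X * atLamAstarHom (d⁄dX ℂ (expo s))) *
        commonFactor s := by
  rw [commonFactor_eq, coeffPderiv_formalExp 0 (constantCoeff_commonExponent s), coeffPderiv_mul,
    coeffPderiv_mul, coeffPderiv_zero_astar, coeffPderiv_zero_alpha, coeffPderiv_zero_atLamAstarHom]
  ring

theorem euler_commonFactor (s : ℂ) :
    euler (commonFactor s) =
      C αstar ^ 2 * C α * X * atLamAstarHom (d⁄dX ℂ (expo s)) * commonFactor s := by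
  rw [commonFactor_eq, euler_formalExp (constantCoeff_commonExponent s), euler_mul, euler_mul,
    euler_C, euler_C, euler_atLamAstarHom]
  ring

/-- As ∂_α ℰ = α* e ℰ, symbols (P + αR)ℰ with P, R free of α are stable under the operator of a†.
Together with `aSymbol_mul_commonFactor` this keeps the degree in α at most one. -/
theorem adSymbol_mul_commonFactor (s : ℂ) {P R : Classical⟦X⟧} (hP : coeffPderiv 1 P = 0)
    (hR : coeffPderiv 1 R = 0) :
    adSymbol s ((P + C α * R) * commonFactor s) =
      ((C αstar * (1 + atLamAstarHom (lowerC s) * atLamAstarHom (expo s)) * P +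
        atLamAstarHom (lowerC s) * R) +
        C α * (C αstar * (1 + atLamAstarHom (lowerC s) * atLamAstarHom (expo s)) * R)) *
        commonFactor s := by
  rw [adSymbol, coeffPderiv_mul, map_add, coeffPderiv_mul, hP, hR, coeffPderiv_one_alpha,
    coeffPderiv_one_commonFactor]
  ring

theorem aSymbol_mul_commonFactor (s : ℂ) (p : ℂ⟦X⟧) :
    aSymbol s (atLamAstarHom p * commonFactor s) =
      (atLamAstarHom (upperC s) * X * atLamAstarHom (d⁄dX ℂ p) +
        C α * (atLamAstarHom p * (1 + atLamAstarHom (upperC s) * (atLamAstarHom (expo s) +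
          C αstar * X * atLamAstarHom (d⁄dX ℂ (expo s)))))) * commonFactor s := by
  rw [aSymbol, coeffPderiv_mul, coeffPderiv_zero_atLamAstarHom, coeffPderiv_zero_commonFactor]
  ring

theorem derivative_expo' (s : ℂ) :
    d⁄dX ℂ (expo s) = (1 + lowerC s * expo s) ^ 2 *
      (1 + upperC s * (expo s + X * d⁄dX ℂ (expo s))) := by
  have h := expo_algebraic s
  have he := derivative_expo s
  apply mul_right_cancel₀ (one_add_upperC_mul_expo_ne_zero s)
  linear_combination he - upperC s * d⁄dX ℂ (expo s) * (1 + lowerC s * expo s) * h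

/-- The differential equation in `λ` of the classical representations. -/
theorem euler_representation (s : ℂ) {j k : ℕ} (hjk : j + k = 2) :
    euler (atLamAstarHom (prefactor s j k) * commonFactor s) =
      X * (adSymbol s (adSymbol s (aSymbol s (atLamAstarHom (prefactor s j k) * commonFactor s))) +
        (k : Classical⟦X⟧) * adSymbol s (atLamAstarHom (prefactor s j k) * commonFactor s)) := by
  have h0 : ∀ {f g : Classical⟦X⟧}, coeffPderiv 1 f = 0 → coeffPderiv 1 g = 0 →
      coeffPderiv 1 (f * g) = 0 := fun hf hg => by rw [coeffPderiv_mul, hf, hg]; ring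
  have h1 : ∀ {f g : Classical⟦X⟧}, coeffPderiv 1 f = 0 → coeffPderiv 1 g = 0 →
      coeffPderiv 1 (f + g) = 0 := fun hf hg => by rw [map_add, hf, hg, add_zero]
  have hA := coeffPderiv_one_atLamAstarHom
  have hu := coeffPderiv_one_astar
  have hX := coeffPderiv_X 1
  have hone : coeffPderiv 1 1 = 0 := by simpa using hA 1
  have hE := congrArg atLamAstarHom (derivative_expo' s)
  have hp := congrArg atLamAstarHom (derivative_prefactor s hjk)
  simp only [map_mul, map_add, map_pow, map_one, map_natCast, map_ofNat, atLamAstarHom_X] at hE hp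
  have hF : adSymbol s (atLamAstarHom (prefactor s j k) * commonFactor s) =
      C αstar * (1 + atLamAstarHom (lowerC s) * atLamAstarHom (expo s)) *
        atLamAstarHom (prefactor s j k) * commonFactor s := by
    have := adSymbol_mul_commonFactor s (hA (prefactor s j k)) (map_zero (coeffPderiv 1))
    simpa using this
  have hP1 : coeffPderiv 1 (atLamAstarHom (upperC s) * X *
      atLamAstarHom (d⁄dX ℂ (prefactor s j k))) = 0 := h0 (h0 (hA _) hX) (hA _)
  have hR1 : coeffPderiv 1 (atLamAstarHom (prefactor s j k) *
      (1 + atLamAstarHom (upperC s) * (atLamAstarHom (expo s) +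
          C αstar * X * atLamAstarHom (d⁄dX ℂ (expo s))))) = 0 :=
    h0 (hA _) (h1 hone (h0 (hA _) (h1 (hA _) (h0 (h0 hu hX) (hA _)))))
  have hw : coeffPderiv 1 (C αstar * (1 + atLamAstarHom (lowerC s) * atLamAstarHom (expo s))) = 0 :=
    h0 hu (h1 hone (h0 (hA _) (hA _)))
  rw [hF, aSymbol_mul_commonFactor, adSymbol_mul_commonFactor s hP1 hR1,
    adSymbol_mul_commonFactor s (h1 (h0 hw hP1) (h0 (hA _) hR1)) (h0 hw hR1), euler_mul,
    euler_atLamAstarHom, euler_commonFactor]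
  generalize atLamAstarHom (d⁄dX ℂ (prefactor s j k)) = p' at *
  generalize atLamAstarHom (prefactor s j k) = p at *
  generalize atLamAstarHom (d⁄dX ℂ (expo s)) = e' at *
  generalize atLamAstarHom (expo s) = e at *
  generalize atLamAstarHom (lowerC s) = c at *
  generalize atLamAstarHom (upperC s) = d at *
  generalize commonFactor s = E at *
  generalize (C αstar : Classical⟦X⟧) = u at *
  generalize (C α : Classical⟦X⟧) = v at *
  generalize (X : Classical⟦X⟧) = x at *
  -- The part free of α (= v) is the prefactor equation, the part linear in α the exponent equation.
  linear_combination x * u * E * hp + p * u ^ 2 * v * x * E * hE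

/-! ### The representations -/

theorem quantize_recursion (s : ℂ) {j k : ℕ} (hjk : j + k = 2) (n : ℕ) :
    ((n : ℂ) + 1) • quantize s (coeff (n + 1) (atLamAstarHom (prefactor s j k) * commonFactor s)) =
      (ad ^ 2 * a + (k : ℂ) • ad) *
        quantize s (coeff n (atLamAstarHom (prefactor s j k) * commonFactor s)) := by
  have h := congrArg (fun f => quantize s (coeff (n + 1) f)) (euler_representation s hjk)
  have hk : (k : Classical⟦X⟧) = C (MvPolynomial.C (k : ℂ)) := by simp
  simp only [coeff_euler, coeff_succ_X_mul, map_add, map_smul] at h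
  rw [hk, coeff_C_mul, ← MvPolynomial.smul_eq_C_mul, map_smul, quantize_coeff_adSymbol,
    quantize_coeff_adSymbol, quantize_coeff_adSymbol, quantize_coeff_aSymbol] at h
  push_cast at h
  rw [h, add_mul, smul_mul_assoc, pow_two, mul_assoc, mul_assoc]

/-- Both sides start at 1 and obey the same recursion, in which n + 1 is invertible. -/
theorem expOp_eq (s : ℂ) {j k : ℕ} (hjk : j + k = 2) :
    expOp (ad ^ 2 * a + (k : ℂ) • ad) =
      quantizeSeries s (atLamAstar (prefactor s j k) * commonFactor s) := by
  rw [atLamAstar_eq]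
  ext1 n
  rw [quantizeSeries, coeff_mk, expOp]
  induction n with
  | zero =>
    have h1 : coeff 0 (atLamAstarHom (prefactor s j k) * commonFactor s) = 1 := by
      have hE : constantCoeff (commonFactor s) = 1 := by
        rw [← coeff_zero_eq_constantCoeff_apply, commonFactor, coeff_zero_formalExp_powerSeries]
      have hp : constantCoeff (atLamAstarHom (prefactor s j k)) = 1 := by
        rw [← coeff_zero_eq_constantCoeff_apply, coeff_atLamAstarHom,
          coeff_zero_eq_constantCoeff_apply, constantCoeff_prefactor, map_one, pow_zero, one_mul]
      rw [coeff_zero_eq_constantCoeff_apply, map_mul, hE, hp, one_mul]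
    rw [h1, quantize_one]
    exact coeff_zero_formalExp_powerSeries _
  | succ n ih =>
    have h0 : (n : ℂ) + 1 ≠ 0 := by exact_mod_cast n.succ_ne_zero
    have h := coeffwise_euler_expOp (ad ^ 2 * a + (k : ℂ) • ad) n
    apply smul_right_injective _ h0
    change ((n : ℂ) + 1) • _ = ((n : ℂ) + 1) • _
    rw [quantize_recursion s hjk n, ← ih]
    exact h

/-- The coefficient of a† after normal ordering is the exponent k of `prefactor`; the casts from ℕ
match `expOp_eq`. -/
theorem ad_mul_a_mul_ad : ad * a * ad = ad ^ 2 * a + ((1 : ℕ) : ℂ) • ad := by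
  rw [mul_assoc, a_mul_ad, mul_add, ← mul_assoc, pow_two, mul_one, Nat.cast_one, one_smul]

theorem a_mul_ad_sq : a * ad ^ 2 = ad ^ 2 * a + ((2 : ℕ) : ℂ) • ad := by
  rw [pow_two, ← mul_assoc, a_mul_ad, add_mul, ad_mul_a_mul_ad, pow_two, one_mul]
  push_cast
  module

theorem ad_sq_mul_a : ad ^ 2 * a = ad ^ 2 * a + ((0 : ℕ) : ℂ) • ad := by
  rw [Nat.cast_zero, zero_smul, add_zero]

end SOrdering

end

theorem mainTheorem6 :
    -- the three representations, wherever the denominators are invertible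
    (∀ s : ℂ, s ≠ -1 →
      SOrdering.expOp (SOrdering.ad ^ 2 * SOrdering.a) =
        SOrdering.quantizeSeries s
          (SOrdering.atLamAstar (SOrdering.prefactor20 s) * SOrdering.commonFactor s)) ∧
    (∀ s : ℂ,
      SOrdering.expOp (SOrdering.ad * SOrdering.a * SOrdering.ad) =
        SOrdering.quantizeSeries s
          (SOrdering.atLamAstar (SOrdering.prefactor11 s) * SOrdering.commonFactor s)) ∧
    (∀ s : ℂ, s ≠ 1 →
      SOrdering.expOp (SOrdering.a * SOrdering.ad ^ 2) =
        SOrdering.quantizeSeries s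
          (SOrdering.atLamAstar (SOrdering.prefactor02 s) * SOrdering.commonFactor s)) ∧
    -- the first at `s = -1`: the prefactor is its coefficientwise limit, which is `1`
    (∀ n : ℕ, Tendsto (fun s : ℂ => PowerSeries.coeff n (SOrdering.prefactor20 s)) (𝓝[≠] (-1))
      (𝓝 (PowerSeries.coeff n (1 : PowerSeries ℂ)))) ∧
    SOrdering.expOp (SOrdering.ad ^ 2 * SOrdering.a) =
      SOrdering.quantizeSeries (-1)
        (SOrdering.atLamAstar (1 : PowerSeries ℂ) * SOrdering.commonFactor (-1)) ∧
    -- the third at `s = 1`: the prefactor is its coefficientwise limit, which is `1`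
    (∀ n : ℕ, Tendsto (fun s : ℂ => PowerSeries.coeff n (SOrdering.prefactor02 s)) (𝓝[≠] 1)
      (𝓝 (PowerSeries.coeff n (1 : PowerSeries ℂ)))) ∧
    SOrdering.expOp (SOrdering.a * SOrdering.ad ^ 2) =
      SOrdering.quantizeSeries 1
        (SOrdering.atLamAstar (1 : PowerSeries ℂ) * SOrdering.commonFactor 1) := by
  refine ⟨fun s hs => ?_, fun s => ?_, fun s hs => ?_, SOrdering.tendsto_coeff_prefactor20, ?_,
    SOrdering.tendsto_coeff_prefactor02, ?_⟩
  · rw [SOrdering.prefactor20_eq hs, SOrdering.ad_sq_mul_a]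
    exact SOrdering.expOp_eq s rfl
  · rw [SOrdering.prefactor11_eq, SOrdering.ad_mul_a_mul_ad]
    exact SOrdering.expOp_eq s rfl
  · rw [SOrdering.prefactor02_eq hs, SOrdering.a_mul_ad_sq]
    exact SOrdering.expOp_eq s rfl
  · rw [← SOrdering.prefactor_two_zero_neg_one, SOrdering.ad_sq_mul_a]
    exact SOrdering.expOp_eq (-1) rfl
  · rw [← SOrdering.prefactor_zero_two_one, SOrdering.a_mul_ad_sq]
    exact SOrdering.expOp_eq 1 rfl
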